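/- Let $d$ be a positive integer. For $n\in\mathbb{N}_0$ and $t\in\mathbb{R}$ let $$h_n(t)=\frac{2^{1/4}}{\sqrt{n!}}\left(-\frac{1}{\sqrt{2\pi}}\right)^n e^{\pi t^2}\left(\frac{d}{dt}\right)^n e^{-2\pi t^2}$$ be the Hermite functions on the real line, and for $k\in\mathbb{N}_0^d$ let $\mathfrak{h}_k(t_1,\dots,t_d)=\prod_{j=1}^d h_{k_j}(t_j)$ be the Hermite functions on $\mathbb{R}^d$. For $f,g\in L^2(\mathbb{R}^d)$ (complex-valued) let $$V_gf(x,\omega)=\int_{\mathbb{R}^d} f(t)\,\overline{g(t-x)}\,e^{-2\pi i\,\omega\cdot t}\,dt,\qquad (x,\omega)\in\mathbb{R}^d\times\mathbb{R}^d=\mathbb{R}^{2d},$$ be the short-time Fourier transform of $f$ with window $g$. Write $\sqrt{\mathbb{Z}}=\{\pm\sqrt{n}:n\in\mathbb{N}_0\}$, and write $f\sim h$ if there is $\tau\in\mathbb{C}$ with $|\tau|=1$ and $f=\tau h$ in $L^2(\mathbb{R}^d)$. Let $\mathfrak{h}=\mathfrak{h}_k$, $k\in\mathbb{N}_0^d$,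 be an arbitrary Hermite function and let $0<\alpha<\sqrt{\frac{1}{2\pi e}}$. Then for every $f,h\in L^2(\mathbb{R}^d)$ the following are equivalent: 1. $|V_{\mathfrak{h}}f(\lambda)|=|V_{\mathfrak{h}}h(\lambda)|$ for every $\lambda\in\alpha(\sqrt{\mathbb{Z}})^{2d}$; 2. $f\sim h$. -/

import Mathlib

open MeasureTheory
open scoped ComplexConjugate Pointwise

/-- Complex-valued `L²(ℝᵈ)` with respect to Lebesgue measure. -/
abbrev L2 (d : ℕ) : Type := Lp ℂ 2 (volume : Measure (EuclideanSpace ℝ (Fin d)))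

/-- The short-time Fourier transform
`V_g f (x, ω) = ∫ f(t) * conj (g (t - x)) * exp (-2πi ω·t) dt`. -/
noncomputable def stft {d : ℕ} (g f : EuclideanSpace ℝ (Fin d) → ℂ)
    (p : EuclideanSpace ℝ (Fin d) × EuclideanSpace ℝ (Fin d)) : ℂ :=
  ∫ t : EuclideanSpace ℝ (Fin d),
    f t * conj (g (t - p.1)) *
      Complex.exp (-2 * Real.pi * Complex.I * ((∑ j, p.2 j * t j : ℝ) : ℂ))

/-- The Hermite functions on the real line,
`h_n(t) = 2^{1/4} / √(n!) * (-1/√(2π))ⁿ * exp (π t²) * (d/dt)ⁿ exp (-2π t²)`. -/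
noncomputable def hermiteFun (n : ℕ) (t : ℝ) : ℝ :=
  (2 : ℝ) ^ (1 / 4 : ℝ) / √(n.factorial : ℝ) * (-(1 / √(2 * Real.pi))) ^ n *
    Real.exp (Real.pi * t ^ 2) *
      iteratedDeriv n (fun s : ℝ => Real.exp (-2 * Real.pi * s ^ 2)) t

/-- The Hermite functions on `ℝᵈ`: tensor products of one-dimensional Hermite functions. -/
noncomputable def hermiteTensor {d : ℕ} (k : Fin d → ℕ) (t : EuclideanSpace ℝ (Fin d)) : ℂ :=
  ((∏ j, hermiteFun (k j) (t j) : ℝ) : ℂ)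

/-- `√ℤ = {±√n : n ∈ ℕ}`. -/
def sqrtInt : Set ℝ := {s | ∃ n : ℕ, s = √(n : ℝ) ∨ s = -√(n : ℝ)}

/-- `(√ℤ)²ᵈ`, as a subset of `ℝᵈ × ℝᵈ`. -/
def sqrtIntPow (d : ℕ) : Set (EuclideanSpace ℝ (Fin d) × EuclideanSpace ℝ (Fin d)) :=
  {p | (∀ j, p.1 j ∈ sqrtInt) ∧ ∀ j, p.2 j ∈ sqrtInt}

/-- Agreement up to a global phase: `f = τ h` for some `τ` of modulus one. -/
def PhaseEquiv {d : ℕ} (f h : L2 d) : Prop := ∃ τ : ℂ, ‖τ‖ = 1 ∧ f = τ • h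

/-! There are two independent mechanisms. First, samples determine the modulus everywhere. A Hermite
function is a polynomial times a Gaussian, so in each real coordinate, with the others fixed and
real, the transform extends to an entire function `F` with `‖F z‖ ≤ C exp(9/2 ‖z‖²)`. Then `F z *
conj (F (conj z))` is entire, equals `‖F‖²` on the real axis and grows at most like `exp(9 ‖z‖²)`.
The difference of two such functions vanishes on `α√ℤ`, which is too dense a zero set for this
growth when `α² < 1/17` (`eq_zero_of_zeros`). Freeing the coordinates one at a time
(`forall_of_forall_update`) gives equal moduli on the whole time-frequency plane.

Second, the full modulus determines `f` up to phase. For fixed `x`, `ω ↦ V f (x, ω)` is a Fourier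
transform, so its squared modulus gives an autocorrelation. As `x` varies, this becomes the
correlation of `r ↦ conj (f r) * f (s + r)` with a product of two Hermite functions, whose Fourier
transform is nonzero on a dense set. Hence `conj (f r) * f t` is determined almost everywhere
(`ae_conj_mul_translate_eq`), and this rank-one kernel fixes `f` up to a unimodular constant. -/

/-! ### Hermite functions as polynomials times a Gaussian. -/

open Polynomial in
theorem derivative_sub_smul_X_mul_ne_zero {P : ℝ[X]} (hP : P ≠ 0) {c : ℝ} (hc : c ≠ 0) :
    derivative P - C c * X * P ≠ 0 := by
  intro h
  have h1 : derivative P = C c * X * P := sub_eq_zero.mp h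
  have h2 := degree_derivative_lt hP
  have h3 : (C c * X * P).degree = P.degree + 1 := by
    rw [degree_mul, degree_C_mul_X hc, add_comm]
  rw [h1, h3, degree_eq_natDegree hP] at h2
  norm_cast at h2
  omega

-- Differentiation replaces the polynomial factor `P` by `P' - 4πXP`, which has larger degree.
-- Nonvanishing of the factor is kept because the window must have only finitely many zeros.
open Polynomial in
theorem exists_iteratedDeriv_gaussian_eq (n : ℕ) : ∃ P : ℝ[X], P ≠ 0 ∧
    iteratedDeriv n (fun s : ℝ => Real.exp (-2 * Real.pi * s ^ 2)) =
      fun t => P.eval t * Real.exp (-2 * Real.pi * t ^ 2) := by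
  induction n with
  | zero => exact ⟨1, one_ne_zero, by simp⟩
  | succ n ih =>
    obtain ⟨P, hP, h⟩ := ih
    refine ⟨derivative P - C (4 * Real.pi) * X * P,
      derivative_sub_smul_X_mul_ne_zero hP (by positivity), ?_⟩
    rw [iteratedDeriv_succ, h]
    funext t
    have h1 : HasDerivAt (fun t : ℝ => -2 * Real.pi * t ^ 2) (-2 * Real.pi * (2 * t)) t := by
      simpa using (hasDerivAt_pow 2 t).const_mul (-2 * Real.pi)
    rw [((P.hasDerivAt t).fun_mul h1.exp).deriv]
    simp only [eval_sub, eval_mul, eval_C, eval_X]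
    ring

open Polynomial in
theorem exists_hermiteFun_eq (n : ℕ) : ∃ P : ℝ[X], P ≠ 0 ∧
    ∀ t, hermiteFun n t = P.eval t * Real.exp (-Real.pi * t ^ 2) := by
  obtain ⟨P, hP, h⟩ := exists_iteratedDeriv_gaussian_eq n
  refine ⟨C ((2 : ℝ) ^ (1 / 4 : ℝ) / √(n.factorial : ℝ) * (-(1 / √(2 * Real.pi))) ^ n) * P,
    mul_ne_zero ?_ hP, fun t => ?_⟩
  · rw [Ne, C_eq_zero]
    refine mul_ne_zero ?_ (pow_ne_zero _ ?_)
    · have := n.factorial_pos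
      positivity
    · rw [neg_ne_zero]
      positivity
  · rw [hermiteFun, h, eval_mul, eval_C]
    have : Real.exp (Real.pi * t ^ 2) * Real.exp (-2 * Real.pi * t ^ 2) =
        Real.exp (-Real.pi * t ^ 2) := by
      rw [← Real.exp_add]; ring_nf
    rw [← this]; ring

/-- The polynomial factor of the `n`-th Hermite function. -/
noncomputable def hermitePoly (n : ℕ) : Polynomial ℝ := (exists_hermiteFun_eq n).choose

theorem hermitePoly_ne_zero (n : ℕ) : hermitePoly n ≠ 0 := (exists_hermiteFun_eq n).choose_spec.1

theorem hermiteFun_eq (n : ℕ) (t : ℝ) :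
    hermiteFun n t = (hermitePoly n).eval t * Real.exp (-Real.pi * t ^ 2) :=
  (exists_hermiteFun_eq n).choose_spec.2 t

theorem continuous_hermiteFun (n : ℕ) : Continuous (hermiteFun n) := by
  simp_rw [funext (hermiteFun_eq n)]
  fun_prop

theorem finite_hermiteFun_eq_zero (n : ℕ) : {t | hermiteFun n t = 0}.Finite := by
  refine ((hermitePoly n).roots.toFinset.finite_toSet).subset fun t ht => ?_
  rw [Set.mem_ofPred_eq, hermiteFun_eq, mul_eq_zero] at ht
  simpa [hermitePoly_ne_zero] using ht.resolve_right (Real.exp_pos _).ne'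

/-- The entire extension of the `n`-th Hermite function. -/
noncomputable def hermiteEntire (n : ℕ) (z : ℂ) : ℂ :=
  ((hermitePoly n).map (algebraMap ℝ ℂ)).eval z * Complex.exp (-Real.pi * z ^ 2)

theorem hermiteEntire_ofReal (n : ℕ) (t : ℝ) : hermiteEntire n t = hermiteFun n t := by
  rw [hermiteEntire, hermiteFun_eq, Polynomial.eval_map_algebraMap]
  have : Polynomial.aeval (t : ℂ) (hermitePoly n) = (((hermitePoly n).eval t : ℝ) : ℂ) :=
    Polynomial.aeval_algebraMap_apply_eq_algebraMap_eval t _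
  rw [this]
  push_cast
  rfl

theorem differentiable_hermiteEntire (n : ℕ) : Differentiable ℂ (hermiteEntire n) := by
  unfold hermiteEntire
  fun_prop

open Polynomial in
theorem exists_norm_eval_le_exp (P : ℂ[X]) {ε : ℝ} (hε : 0 < ε) :
    ∃ C, 0 ≤ C ∧ ∀ z, ‖P.eval z‖ ≤ C * Real.exp (ε * ‖z‖ ^ 2) := by
  induction P using Polynomial.induction_on' with
  | add p q hp hq =>
    obtain ⟨C, hC, h⟩ := hp
    obtain ⟨D, hD, h'⟩ := hq
    refine ⟨C + D, by positivity, fun z => ?_⟩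
    rw [eval_add, add_mul]
    exact (norm_add_le _ _).trans (add_le_add (h z) (h' z))
  | monomial n a =>
    refine ⟨‖a‖ * (1 + n.factorial / ε ^ n), by positivity, fun z => ?_⟩
    rw [eval_monomial, norm_mul, norm_pow, mul_assoc]
    gcongr
    have h1 : ‖z‖ ^ n ≤ 1 + (‖z‖ ^ 2) ^ n := by
      rw [← pow_mul, mul_comm 2 n, pow_mul]
      nlinarith [sq_nonneg (‖z‖ ^ n - 1), pow_nonneg (norm_nonneg z) n]
    have h2 := Real.pow_div_factorial_le_exp (ε * ‖z‖ ^ 2) (by positivity) n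
    rw [mul_pow, div_le_iff₀ (by positivity)] at h2
    have h3 : (‖z‖ ^ 2) ^ n ≤ n.factorial / ε ^ n * Real.exp (ε * ‖z‖ ^ 2) := by
      rw [div_mul_eq_mul_div, le_div_iff₀ (by positivity)]
      linarith
    have h4 : 1 ≤ Real.exp (ε * ‖z‖ ^ 2) := Real.one_le_exp (by positivity)
    linarith

theorem exists_norm_hermiteEntire_le (n : ℕ) : ∃ C, 0 ≤ C ∧ ∀ z : ℂ,
    ‖hermiteEntire n z‖ ≤ C * Real.exp (-3 * z.re ^ 2 + 4 * z.im ^ 2) := by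
  -- With `ε = 1/10`, both `π - ε ≥ 3` and `π + ε ≤ 4` hold, which gives the exponents.
  obtain ⟨C, hC, h⟩ := exists_norm_eval_le_exp ((hermitePoly n).map (algebraMap ℝ ℂ))
    (ε := 1 / 10) (by norm_num)
  refine ⟨C, hC, fun z => ?_⟩
  rw [hermiteEntire, norm_mul, Complex.norm_exp]
  have h1 : (-(Real.pi : ℂ) * z ^ 2).re = -Real.pi * (z.re ^ 2 - z.im ^ 2) := by
    simp [pow_two]
  calc _ ≤ C * Real.exp (1 / 10 * ‖z‖ ^ 2) * Real.exp (-(Real.pi : ℂ) * z ^ 2).re := by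
        gcongr; exact h z
    _ ≤ _ := by
        rw [mul_assoc, ← Real.exp_add, h1, Complex.sq_norm, Complex.normSq_apply]
        refine mul_le_mul_of_nonneg_left (Real.exp_le_exp.mpr ?_) hC
        nlinarith [Real.pi_gt_d2, Real.pi_lt_d2, sq_nonneg z.re, sq_nonneg z.im]

/-! ### Gaussian bounds on the kernel at complex points. -/

/-- The one-dimensional factor of the integrand of the short-time Fourier transform, at a complex
point of the time-frequency plane. -/
noncomputable def stftKernel (n : ℕ) (X Ω : ℂ) (t : ℝ) : ℂ :=
  hermiteEntire n (t - X) * Complex.exp (-2 * Real.pi * Complex.I * (Ω * t))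

theorem exists_norm_stftKernel_le (n : ℕ) : ∃ C, 0 ≤ C ∧ ∀ (X Ω : ℂ) (t : ℝ),
    ‖stftKernel n X Ω t‖ ≤
      C * Real.exp (-3 * (t - X.re) ^ 2 + 4 * X.im ^ 2 + 2 * Real.pi * (Ω.im * t)) := by
  obtain ⟨C, hC, h⟩ := exists_norm_hermiteEntire_le n
  refine ⟨C, hC, fun X Ω t => ?_⟩
  have h1 : (-2 * (Real.pi : ℂ) * Complex.I * (Ω * t)).re = 2 * Real.pi * (Ω.im * t) := by
    simp
  rw [stftKernel, norm_mul, Complex.norm_exp, Real.exp_add, h1, ← mul_assoc C]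
  refine mul_le_mul_of_nonneg_right ?_ (Real.exp_pos _).le
  simpa using h (t - X)

theorem exists_norm_stftKernel_time_le (n : ℕ) (ω : ℝ) : ∃ C, 0 ≤ C ∧ ∀ (z : ℂ) (t : ℝ),
    ‖stftKernel n z ω t‖ ≤ C * Real.exp (9 / 2 * ‖z‖ ^ 2) * Real.exp (-(1 / 2) * t ^ 2) := by
  obtain ⟨C, hC, h⟩ := exists_norm_stftKernel_le n
  refine ⟨C, hC, fun z t => (h z ω t).trans ?_⟩
  rw [mul_assoc C, ← Real.exp_add, Complex.sq_norm, Complex.normSq_apply]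
  refine mul_le_mul_of_nonneg_left (Real.exp_le_exp.mpr ?_) hC
  simp only [Complex.ofReal_im, zero_mul, mul_zero, add_zero]
  nlinarith [sq_nonneg (2 * t - 3 * z.re), sq_nonneg z.re, sq_nonneg z.im, sq_nonneg t]

theorem exists_norm_stftKernel_freq_le (n : ℕ) (x : ℝ) : ∃ C, 0 ≤ C ∧ ∀ (z : ℂ) (t : ℝ),
    ‖stftKernel n x z t‖ ≤ C * Real.exp (9 / 2 * ‖z‖ ^ 2) * Real.exp (-(1 / 2) * t ^ 2) := by
  obtain ⟨C, hC, h⟩ := exists_norm_stftKernel_le n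
  -- The cross term `6tx` is absorbed by `t²/4 + 36x²`; since `x` is fixed, the second summand goes
  -- into the constant.
  refine ⟨C * Real.exp (36 * x ^ 2), by positivity, fun z t => (h x z t).trans ?_⟩
  rw [mul_assoc C, mul_assoc C, ← Real.exp_add, ← Real.exp_add, Complex.sq_norm,
    Complex.normSq_apply]
  refine mul_le_mul_of_nonneg_left (Real.exp_le_exp.mpr ?_) hC
  simp only [Complex.ofReal_im, Complex.ofReal_re]
  have h1 : 2 * Real.pi * (z.im * t) ≤ 9 / 4 * t ^ 2 + 9 / 2 * z.im ^ 2 := by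
    have h2 : 0 ≤ (3 / 2 * t - 2 * Real.pi / 3 * z.im) ^ 2 := sq_nonneg _
    have h3 : Real.pi ^ 2 ≤ 10 := by nlinarith [Real.pi_gt_d2, Real.pi_lt_d2]
    nlinarith [mul_le_mul_of_nonneg_right h3 (sq_nonneg z.im)]
  nlinarith [sq_nonneg (t / 2 - 6 * x), sq_nonneg z.re, sq_nonneg x]

/-! ### Uniqueness for entire functions of order two vanishing on `a√ℤ`. -/

theorem Differentiable.dslope {f : ℂ → ℂ} (hf : Differentiable ℂ f) (c : ℂ) :
    Differentiable ℂ (dslope f c) := by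
  rw [← differentiableOn_univ] at hf ⊢
  exact (Complex.differentiableOn_dslope Filter.univ_mem).mpr hf

/-- Zeros of an entire function can be divided out. -/
theorem Differentiable.exists_eq_prod_sub_mul {f : ℂ → ℂ} (hf : Differentiable ℂ f) (s : Finset ℂ)
    (hs : ∀ a ∈ s, f a = 0) :
    ∃ q : ℂ → ℂ, Differentiable ℂ q ∧ ∀ z, f z = (∏ a ∈ s, (z - a)) * q z := by
  classical
  induction s using Finset.induction_on with
  | empty => exact ⟨f, hf, by simp⟩
  | insert a s ha ih =>
    obtain ⟨q, hq, h⟩ := ih fun b hb => hs b (Finset.mem_insert_of_mem hb)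
    have hqa : q a = 0 := by
      have h1 := hs a (Finset.mem_insert_self a s)
      rw [h, mul_eq_zero] at h1
      refine h1.resolve_left (Finset.prod_ne_zero_iff.mpr fun b hb => sub_ne_zero.mpr ?_)
      rintro rfl
      exact ha hb
    refine ⟨_, hq.dslope a, fun z => ?_⟩
    have h2 : (z - a) * _root_.dslope q a z = q z := by
      simpa [hqa] using sub_smul_dslope q a z
    rw [Finset.prod_insert ha, h, ← h2]
    ring

/-- A Jensen-type estimate: divide out the zeros `±a√n`, `n ≤ N`, and apply the maximum principle to
the quotient. On the circle `‖z‖² = 2a²N` each factor satisfies `‖z² - a²n‖ ≥ a²(2N - n)`, while at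
the origin it has modulus `a²n`. -/
theorem norm_zero_le_of_zeros {f : ℂ → ℂ} (hf : Differentiable ℂ f) {a : ℝ} (ha : 0 < a)
    (hz : ∀ n : ℕ, 1 ≤ n → f (a * √n : ℝ) = 0 ∧ f (-(a * √n) : ℝ) = 0) {N : ℕ} (hN : 1 ≤ N)
    {M : ℝ} (hM : ∀ z, ‖z‖ ^ 2 = 2 * a ^ 2 * N → ‖f z‖ ≤ M) :
    ‖f 0‖ * ∏ n ∈ Finset.Icc 1 N, ((2 * N - n : ℝ)) ≤ M * N.factorial := by
  classical
  set p : ℕ → ℂ := fun n => (a * √n : ℝ) with hp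
  set m : ℕ → ℂ := fun n => (-(a * √n) : ℝ) with hm
  have hinj : Function.Injective p := by
    intro i j hij
    simp only [hp, Complex.ofReal_inj] at hij
    have := (mul_right_inj' ha.ne').mp hij
    rw [Real.sqrt_inj (by positivity) (by positivity)] at this
    exact_mod_cast this
  have hinj' : Function.Injective m := by
    intro i j hij
    simp only [hm, Complex.ofReal_inj, neg_inj] at hij
    exact hinj (by simp only [hp, hij])
  set S := Finset.Icc 1 N with hS
  have hdisj : Disjoint (S.image p) (S.image m) := by
    rw [Finset.disjoint_left]
    intro x hx hx'
    obtain ⟨i, hi, rfl⟩ := Finset.mem_image.mp hx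
    obtain ⟨j, hj, hj'⟩ := Finset.mem_image.mp hx'
    simp only [hp, hm, Complex.ofReal_inj] at hj'
    have h1 : 0 < a * √(i : ℝ) := by
      have : 0 < (i : ℝ) := by exact_mod_cast (Finset.mem_Icc.mp hi).1
      positivity
    have h2 : 0 ≤ a * √(j : ℝ) := by positivity
    linarith
  obtain ⟨q, hq, h⟩ := hf.exists_eq_prod_sub_mul (S.image p ∪ S.image m) (by
    intro x hx
    rcases Finset.mem_union.mp hx with hx | hx <;> obtain ⟨i, hi, rfl⟩ := Finset.mem_image.mp hx
    · exact (hz i (Finset.mem_Icc.mp hi).1).1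
    · exact (hz i (Finset.mem_Icc.mp hi).1).2)
  have hprod : ∀ z, f z = (∏ n ∈ S, (z ^ 2 - (a ^ 2 * n : ℝ))) * q z := by
    intro z
    rw [h, Finset.prod_union hdisj, Finset.prod_image hinj.injOn, Finset.prod_image hinj'.injOn,
      ← Finset.prod_mul_distrib]
    congr 1
    refine Finset.prod_congr rfl fun n _ => ?_
    simp only [hp, hm, Complex.ofReal_neg]
    rw [show a ^ 2 * n = (a * √n) ^ 2 by rw [mul_pow, Real.sq_sqrt (by positivity)]]
    push_cast
    ring
  set R := √(2 * a ^ 2 * N) with hR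
  have hNpos : (0 : ℝ) < N := by exact_mod_cast hN
  have hRpos : 0 < R := by positivity
  have hR2 : R ^ 2 = 2 * a ^ 2 * N := Real.sq_sqrt (by positivity)
  have hbpos : ∀ n ∈ S, 0 < (2 * N - n : ℝ) := by
    intro n hn
    have : (n : ℝ) ≤ N := by exact_mod_cast (Finset.mem_Icc.mp hn).2
    linarith
  set B := ∏ n ∈ S, (2 * N - n : ℝ) with hB
  have hBpos : 0 < B := Finset.prod_pos hbpos
  have hq0 : ‖q 0‖ ≤ M / ((a ^ 2) ^ N * B) := by
    refine Complex.norm_le_of_forall_mem_frontier_norm_le (U := Metric.ball 0 R)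
      Metric.isBounded_ball hq.diffContOnCl (fun z hz => ?_) (subset_closure (by simpa))
    rw [frontier_ball _ hRpos.ne', mem_sphere_zero_iff_norm] at hz
    have h1 := hM z (by rw [hz, hR2])
    rw [hprod, norm_mul] at h1
    rw [le_div_iff₀ (by positivity), mul_comm]
    refine le_trans ?_ h1
    gcongr
    rw [norm_prod]
    have hcard : (a ^ 2) ^ N * B = ∏ n ∈ S, (a ^ 2 * (2 * N - n : ℝ)) := by
      rw [Finset.prod_mul_distrib, Finset.prod_const, hS, Nat.card_Icc, Nat.add_sub_cancel]
    rw [hcard]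
    refine Finset.prod_le_prod (fun n hn => mul_nonneg (by positivity) (hbpos n hn).le)
      fun n hn => ?_
    have h2 := norm_sub_norm_le (z ^ 2) ((a ^ 2 * n : ℝ) : ℂ)
    rw [norm_pow, hz, hR2, Complex.norm_real, Real.norm_of_nonneg (by positivity)] at h2
    linarith
  have h0 : ‖f 0‖ = (a ^ 2) ^ N * N.factorial * ‖q 0‖ := by
    rw [hprod, norm_mul, norm_prod]
    congr 1
    have : ∀ n ∈ S, ‖(0 : ℂ) ^ 2 - (a ^ 2 * n : ℝ)‖ = a ^ 2 * n := by
      intro n _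
      rw [zero_pow two_ne_zero, zero_sub, norm_neg, Complex.norm_real,
        Real.norm_of_nonneg (by positivity)]
    rw [Finset.prod_congr rfl this, Finset.prod_mul_distrib, Finset.prod_const, hS, Nat.card_Icc,
      Nat.add_sub_cancel]
    congr 1
    rw [← Nat.cast_prod, ← Finset.Ico_add_one_right_eq_Icc, Finset.prod_Ico_id_eq_factorial]
  rw [h0]
  rw [le_div_iff₀ (by positivity)] at hq0
  calc _ = ‖q 0‖ * ((a ^ 2) ^ N * B) * N.factorial := by ring
    _ ≤ _ := by gcongr

/-- The product is `(2N-1)!/(N-1)!`, that is, half of `N!` times the central binomial coefficient,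
which is at least `4^N/(2N)`. -/
theorem four_pow_mul_factorial_le_prod {N : ℕ} (hN : 1 ≤ N) :
    (4 : ℝ) ^ N * N.factorial ≤ 4 * N * ∏ n ∈ Finset.Icc 1 N, ((2 * N - n : ℝ)) := by
  have h1 : (∏ n ∈ Finset.Icc 1 N, (2 * N - n : ℝ)) = ((2 * N - 1).descFactorial N : ℕ) := by
    rw [Nat.descFactorial_eq_prod_range, Nat.cast_prod, ← Finset.Ico_add_one_right_eq_Icc,
      Finset.prod_Ico_eq_prod_range]
    refine Finset.prod_congr rfl fun i hi => ?_
    have hi' := Finset.mem_range.mp hi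
    rw [Nat.cast_sub (by omega), Nat.cast_sub (by omega)]
    push_cast
    ring
  have h2 : 2 * (2 * N - 1).descFactorial N = N.factorial * N.centralBinom := by
    have h3 := Nat.succ_descFactorial_succ (2 * N - 1) N
    rw [Nat.sub_add_cancel (by omega), Nat.descFactorial_succ,
      Nat.descFactorial_eq_factorial_mul_choose, ← Nat.centralBinom_eq_two_mul_choose] at h3
    have h4 : 2 * N - N = N := by omega
    rw [h4] at h3
    have h5 : N * (2 * (2 * N - 1).descFactorial N) = N * (N.factorial * N.centralBinom) := by
      rw [h3]; ring
    exact Nat.eq_of_mul_eq_mul_left (by omega) h5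
  have h3 := Nat.four_pow_le_two_mul_self_mul_centralBinom N hN
  rw [h1]
  have h4 : 4 ^ N * N.factorial ≤ 4 * N * (2 * N - 1).descFactorial N := by
    calc 4 ^ N * N.factorial ≤ 2 * N * N.centralBinom * N.factorial := by gcongr
      _ = 2 * N * (N.factorial * N.centralBinom) := by ring
      _ = _ := by rw [← h2]; ring
  exact_mod_cast h4

theorem eq_zero_at_zero_of_zeros {f : ℂ → ℂ} (hf : Differentiable ℂ f) {a : ℝ} (ha : 0 < a)
    (ha' : a ^ 2 < 1 / 17)
    (hz : ∀ n : ℕ, 1 ≤ n → f (a * √n : ℝ) = 0 ∧ f (-(a * √n) : ℝ) = 0)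
    {C : ℝ} (hC : ∀ z, ‖f z‖ ≤ C * Real.exp (9 * ‖z‖ ^ 2)) : f 0 = 0 := by
  have hC0 : 0 ≤ C := by simpa using (norm_nonneg _).trans (hC 0)
  -- On the circle the growth bound is `exp(18a²N) ≤ exp(18/17)^N`, against a gain of `4^N/(4N)`
  -- from the zeros. The ratio is below one since `e^18 < 4^17`.
  set r := Real.exp (18 / 17) / 4 with hr
  have hr0 : 0 < r := by positivity
  have hr1 : r < 1 := by
    have h1 : Real.exp (18 / 17) ^ 17 < 4 ^ 17 := by
      rw [← Real.exp_nat_mul]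
      have : ((17 : ℕ) : ℝ) * (18 / 17) = (18 : ℕ) * 1 := by norm_num
      rw [this, Real.exp_nat_mul]
      calc Real.exp 1 ^ 18 ≤ (2.7182818286 : ℝ) ^ 18 := by
            gcongr; exact Real.exp_one_lt_d9.le
        _ < _ := by norm_num
    have := lt_of_pow_lt_pow_left₀ 17 (by norm_num) h1
    rw [hr, div_lt_one (by norm_num)]
    exact this
  have key : ∀ N : ℕ, 1 ≤ N → ‖f 0‖ ≤ 4 * C * (N * r ^ N) := by
    intro N hN
    have hM : ∀ z : ℂ, ‖z‖ ^ 2 = 2 * a ^ 2 * N → ‖f z‖ ≤ C * Real.exp (18 / 17) ^ N := by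
      intro z hz'
      refine (hC z).trans ?_
      rw [← Real.exp_nat_mul, hz']
      refine mul_le_mul_of_nonneg_left (Real.exp_le_exp.mpr ?_) hC0
      have : (0 : ℝ) ≤ N := by positivity
      nlinarith
    have h1 := norm_zero_le_of_zeros hf ha hz hN hM
    have h2 := four_pow_mul_factorial_le_prod hN
    have h3 : (0 : ℝ) < N.factorial := by exact_mod_cast N.factorial_pos
    have h4 : ‖f 0‖ * (4 ^ N * N.factorial) ≤ 4 * N * (C * Real.exp (18 / 17) ^ N) * N.factorial := by
      calc _ ≤ ‖f 0‖ * (4 * N * ∏ n ∈ Finset.Icc 1 N, ((2 * N - n : ℝ))) := by gcongr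
        _ = 4 * N * (‖f 0‖ * ∏ n ∈ Finset.Icc 1 N, ((2 * N - n : ℝ))) := by ring
        _ ≤ 4 * N * (C * Real.exp (18 / 17) ^ N * N.factorial) := by gcongr
        _ = _ := by ring
    rw [← mul_assoc] at h4
    have h5 := le_of_mul_le_mul_right h4 h3
    rw [hr, div_pow]
    rw [← le_div_iff₀ (by positivity)] at h5
    refine h5.trans_eq ?_
    ring
  have hlim : Filter.Tendsto (fun N : ℕ => 4 * C * (N * r ^ N)) Filter.atTop (nhds 0) := by
    simpa using (tendsto_self_mul_const_pow_of_lt_one hr0.le hr1).const_mul (4 * C)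
  have := ge_of_tendsto hlim (Filter.eventually_atTop.mpr ⟨1, fun N hN => key N hN⟩)
  simpa using this

/-- Division by `z` does not increase the modulus outside the unit disc, and compactness bounds the
quotient inside. -/
theorem exists_norm_dslope_le {f : ℂ → ℂ} (hf : Differentiable ℂ f) (h0 : f 0 = 0)
    {C : ℝ} (hC : ∀ z, ‖f z‖ ≤ C * Real.exp (9 * ‖z‖ ^ 2)) :
    ∃ D : ℝ, ∀ z, ‖dslope f 0 z‖ ≤ D * Real.exp (9 * ‖z‖ ^ 2) := by
  have hC0 : 0 ≤ C := by simpa using (norm_nonneg _).trans (hC 0)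
  obtain ⟨B, hB⟩ := (isCompact_closedBall (0 : ℂ) 1).exists_bound_of_continuousOn
    (hf.dslope 0).continuous.continuousOn
  have hB0 : 0 ≤ B := (norm_nonneg _).trans (hB 0 (by simp))
  refine ⟨B + C, fun z => ?_⟩
  rw [add_mul]
  rcases le_total ‖z‖ 1 with hz | hz
  · have h1 : 1 ≤ Real.exp (9 * ‖z‖ ^ 2) := Real.one_le_exp (by positivity)
    have h2 := hB z (by simpa using hz)
    have : 0 ≤ C * Real.exp (9 * ‖z‖ ^ 2) := by positivity
    nlinarith
  · have h2 : z * dslope f 0 z = f z := by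
      simpa [h0] using sub_smul_dslope f 0 z
    have h3 : ‖dslope f 0 z‖ ≤ ‖f z‖ := by
      rw [← h2, norm_mul]
      exact le_mul_of_one_le_left (norm_nonneg _) hz
    have : 0 ≤ B * Real.exp (9 * ‖z‖ ^ 2) := by positivity
    linarith [hC z]

/-- An entire function of order two and small type is determined by its values on `a √ℤ`. -/
theorem eq_zero_of_zeros {f : ℂ → ℂ} (hf : Differentiable ℂ f) {a : ℝ} (ha : 0 < a)
    (ha' : a ^ 2 < 1 / 17)
    (hz : ∀ s ∈ sqrtInt, f (a * s : ℝ) = 0)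
    {C : ℝ} (hC : ∀ z, ‖f z‖ ≤ C * Real.exp (9 * ‖z‖ ^ 2)) : f = 0 := by
  -- Each division by `z` preserves the nonzero zeros and the growth type, so the vanishing at `0`
  -- can be applied again to every quotient, whatever the order of the zero there.
  have hit : ∀ m : ℕ, Differentiable ℂ ((Function.swap dslope (0 : ℂ))^[m] f) ∧
      (∀ n : ℕ, 1 ≤ n → (Function.swap dslope (0 : ℂ))^[m] f (a * √n : ℝ) = 0 ∧
        (Function.swap dslope (0 : ℂ))^[m] f (-(a * √n) : ℝ) = 0) ∧
      ∃ D : ℝ, ∀ z, ‖(Function.swap dslope (0 : ℂ))^[m] f z‖ ≤ D * Real.exp (9 * ‖z‖ ^ 2) := by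
    intro m
    induction m with
    | zero =>
      refine ⟨hf, fun n _ => ⟨hz _ ⟨n, Or.inl rfl⟩, ?_⟩, C, hC⟩
      simpa using hz _ ⟨n, Or.inr rfl⟩
    | succ m ih =>
      obtain ⟨h1, h2, D, h3⟩ := ih
      rw [Function.iterate_succ_apply']
      set g := (Function.swap dslope (0 : ℂ))^[m] f
      have h0 := eq_zero_at_zero_of_zeros h1 ha ha' h2 h3
      refine ⟨h1.dslope 0, fun n hn => ?_, exists_norm_dslope_le h1 h0 h3⟩
      have hne : (a * √n) ≠ 0 := by
        have : (0 : ℝ) < n := by exact_mod_cast hn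
        positivity
      have key : ∀ x : ℝ, x ≠ 0 → g x = 0 → Function.swap dslope 0 g (x : ℂ) = 0 := by
        intro x hx hgx
        rw [Function.swap, dslope_of_ne _ (by exact_mod_cast hx), slope_def_field, h0, hgx]
        simp
      exact ⟨key _ hne (h2 n hn).1, key _ (neg_ne_zero.mpr hne) (h2 n hn).2⟩
  obtain ⟨p, hp⟩ := hf.analyticAt 0
  have hp0 : p = 0 := by
    by_contra hne
    -- Dividing exactly `p.order` times would leave the leading Taylor coefficient as the value at
    -- `0`.
    refine hp.iterate_dslope_fslope_ne_zero hne ?_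
    obtain ⟨h1, h2, D, h3⟩ := hit p.order
    exact eq_zero_at_zero_of_zeros h1 ha ha' h2 h3
  have hev : f =ᶠ[nhds 0] 0 := hp.locally_zero_iff.mpr hp0
  exact AnalyticOnNhd.eq_of_eventuallyEq (fun z _ => hf.analyticAt z)
    (fun z _ => analyticAt_const) hev

/-! ### Entire extension of the transform in one coordinate. -/

open Filter Topology in
/-- A locally dominated integral of entire functions is entire. -/
theorem differentiable_integral_of_dominated {T : Type*} [MeasurableSpace T] {μ : Measure T}
    {F : ℂ → T → ℂ} (hd : ∀ a, Differentiable ℂ fun z => F z a)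
    (hm : ∀ z, AEStronglyMeasurable (F z) μ)
    (hb : ∀ R : ℝ, ∃ b : T → ℝ, Integrable b μ ∧ ∀ z, ‖z‖ ≤ R → ∀ a, ‖F z a‖ ≤ b a) :
    Differentiable ℂ fun z => ∫ a, F z a ∂μ := by
  intro z₀
  -- Radius one for the neighbourhood of `z₀`, plus one for the Cauchy circle that bounds the
  -- derivative.
  obtain ⟨b, hbi, hb⟩ := hb (‖z₀‖ + 2)
  have hderiv : ∀ a, ∀ z ∈ Metric.ball z₀ 1, ‖deriv (fun z => F z a) z‖ ≤ b a := by
    intro a z hz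
    have h := Complex.norm_deriv_le_of_forall_mem_sphere_norm_le (c := z) (R := 1) (C := b a)
      one_pos (hd a).diffContOnCl fun w hw => hb w ?_ a
    · simpa using h
    · have h1 : ‖w - z‖ = 1 := by simpa using hw
      have h2 : ‖z - z₀‖ < 1 := by simpa [dist_eq_norm] using hz
      calc ‖w‖ = ‖z₀ + (z - z₀) + (w - z)‖ := by congr 1; ring
        _ ≤ ‖z₀‖ + ‖z - z₀‖ + ‖w - z‖ := norm_add₃_le
        _ ≤ _ := by linarith
  -- The derivative is a sequential limit of measurable difference quotients.
  have hmeas : AEStronglyMeasurable (fun a => deriv (fun z => F z a) z₀) μ := by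
    have hu : Tendsto (fun n : ℕ => z₀ + 1 / ((n : ℂ) + 1)) atTop (𝓝[≠] z₀) := by
      refine tendsto_nhdsWithin_iff.mpr ⟨?_, Eventually.of_forall fun n => ?_⟩
      · simpa using tendsto_const_nhds.add (tendsto_one_div_add_atTop_nhds_zero_nat (𝕜 := ℂ))
      · simp [Nat.cast_add_one_ne_zero]
    refine aestronglyMeasurable_of_tendsto_ae atTop
      (f := fun (n : ℕ) a => slope (fun z => F z a) z₀ (z₀ + 1 / ((n : ℂ) + 1)))
      (fun n => ?_) (Eventually.of_forall fun a => ?_)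
    · simp only [slope_def_field, div_eq_mul_inv]
      exact ((hm _).sub (hm _)).mul_const _
    · exact (hasDerivAt_iff_tendsto_slope.mp (hd a z₀).hasDerivAt).comp hu
  exact (hasDerivAt_integral_of_dominated_loc_of_deriv_le (Metric.ball_mem_nhds z₀ one_pos)
    (Eventually.of_forall hm)
    (hbi.mono' (hm z₀) (Eventually.of_forall fun a => hb z₀ (by linarith) a)) hmeas
    (Eventually.of_forall hderiv) hbi
    (Eventually.of_forall fun a z _ => (hd a z).hasDerivAt)).2.differentiableAt

theorem integrable_exp_neg_mul_sq_norm {d : ℕ} {b : ℝ} (hb : 0 < b) :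
    Integrable fun t : EuclideanSpace ℝ (Fin d) => Real.exp (-b * ‖t‖ ^ 2) := by
  have h := (GaussianFourier.integrable_cexp_neg_mul_sq_norm_add (b := (b : ℂ)) (by simpa using hb)
    0 (0 : EuclideanSpace ℝ (Fin d))).norm
  refine h.congr (Filter.Eventually.of_forall fun t => ?_)
  simp only [Complex.norm_exp]
  norm_cast
  simp

theorem memLp_two_exp_neg_mul_sq_norm {d : ℕ} {b : ℝ} (hb : 0 < b) :
    MemLp (fun t : EuclideanSpace ℝ (Fin d) => Real.exp (-b * ‖t‖ ^ 2)) 2 := by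
  rw [memLp_two_iff_integrable_sq (by fun_prop)]
  refine (integrable_exp_neg_mul_sq_norm (d := d) (mul_pos two_pos hb)).congr
    (Filter.Eventually.of_forall fun t => ?_)
  simp only
  rw [← Real.exp_nat_mul]
  congr 1
  push_cast
  ring

/-- The short-time Fourier transform with a Hermite window at complex points. -/
noncomputable def stftEntire {d : ℕ} (k : Fin d → ℕ) (f : EuclideanSpace ℝ (Fin d) → ℂ)
    (p : Fin d ⊕ Fin d → ℂ) : ℂ :=
  ∫ t : EuclideanSpace ℝ (Fin d), f t * ∏ j, stftKernel (k j) (p (.inl j)) (p (.inr j)) (t j)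

theorem stftEntire_ofReal {d : ℕ} (k : Fin d → ℕ) (f : EuclideanSpace ℝ (Fin d) → ℂ)
    (p : EuclideanSpace ℝ (Fin d) × EuclideanSpace ℝ (Fin d)) :
    stftEntire k f (fun i => ((Sum.elim p.1 p.2 i : ℝ) : ℂ)) = stft (hermiteTensor k) f p := by
  unfold stftEntire stft
  congr 1 with t
  rw [mul_assoc]
  congr 1
  simp only [stftKernel, Sum.elim_inl, Sum.elim_inr, Finset.prod_mul_distrib, hermiteTensor,
    Complex.conj_ofReal]
  congr 1
  · push_cast
    refine Finset.prod_congr rfl fun j _ => ?_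
    rw [← hermiteEntire_ofReal]
    simp
  · rw [← Complex.exp_sum, ← Finset.mul_sum]
    push_cast
    rfl

/-- Only the tensor factor containing coordinate `i` depends on `z`, so the growth `exp(9/2 ‖z‖²)`
enters once, independently of the dimension. -/
theorem exists_norm_prod_stftKernel_le {d : ℕ} (k : Fin d → ℕ) (p : Fin d ⊕ Fin d → ℝ)
    (i : Fin d ⊕ Fin d) : ∃ C : ℝ, 0 ≤ C ∧ ∀ (z : ℂ) (t : EuclideanSpace ℝ (Fin d)),
      ‖∏ j, stftKernel (k j) (Function.update (fun m => (p m : ℂ)) i z (.inl j))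
        (Function.update (fun m => (p m : ℂ)) i z (.inr j)) (t j)‖ ≤
      C * Real.exp (9 / 2 * ‖z‖ ^ 2) * Real.exp (-(1 / 2) * ‖t‖ ^ 2) := by
  obtain ⟨a, ha⟩ : ∃ a, i = .inl a ∨ i = .inr a := by
    rcases i with a | a
    exacts [⟨a, .inl rfl⟩, ⟨a, .inr rfl⟩]
  have h : ∀ j, ∃ C : ℝ, 0 ≤ C ∧ ∀ (z : ℂ) (t : ℝ),
      ‖stftKernel (k j) (Function.update (fun m => (p m : ℂ)) i z (.inl j))
        (Function.update (fun m => (p m : ℂ)) i z (.inr j)) t‖ ≤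
      C * (if j = a then Real.exp (9 / 2 * ‖z‖ ^ 2) else 1) * Real.exp (-(1 / 2) * t ^ 2) := by
    intro j
    by_cases hj : j = a
    · subst hj
      rcases ha with rfl | rfl
      · simpa using exists_norm_stftKernel_time_le (k j) (p (.inr j))
      · simpa using exists_norm_stftKernel_freq_le (k j) (p (.inl j))
    · obtain ⟨C, hC, h⟩ := exists_norm_stftKernel_freq_le (k j) (p (.inl j))
      refine ⟨C * Real.exp (9 / 2 * ‖(p (.inr j) : ℂ)‖ ^ 2), by positivity, fun z t => ?_⟩
      rcases ha with rfl | rfl <;> simpa [hj] using h (p (.inr j)) t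
  choose C hC h using h
  refine ⟨∏ j, C j, Finset.prod_nonneg fun j _ => hC j, fun z t => ?_⟩
  rw [norm_prod, EuclideanSpace.real_norm_sq_eq, Finset.mul_sum, Real.exp_sum]
  have h1 : Real.exp (9 / 2 * ‖z‖ ^ 2) =
      ∏ j, (if j = a then Real.exp (9 / 2 * ‖z‖ ^ 2) else 1) := by simp
  rw [h1, ← Finset.prod_mul_distrib, ← Finset.prod_mul_distrib]
  exact Finset.prod_le_prod (fun j _ => norm_nonneg _) fun j _ => h j z (t j)

theorem Differentiable.update {ι : Type*} [DecidableEq ι] (p : ι → ℂ) (i m : ι) :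
    Differentiable ℂ fun z : ℂ => Function.update p i z m := by
  by_cases h : m = i
  · subst h; simp
  · simp [h]

theorem stftEntire_update {d : ℕ} (k : Fin d → ℕ) {f : EuclideanSpace ℝ (Fin d) → ℂ}
    (hf : MemLp f 2) (p : Fin d ⊕ Fin d → ℝ) (i : Fin d ⊕ Fin d) :
    (Differentiable ℂ fun z => stftEntire k f (Function.update (fun m => (p m : ℂ)) i z)) ∧
    ∃ C : ℝ, 0 ≤ C ∧ ∀ z, ‖stftEntire k f (Function.update (fun m => (p m : ℂ)) i z)‖ ≤
      C * Real.exp (9 / 2 * ‖z‖ ^ 2) := by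
  obtain ⟨C, hC, h⟩ := exists_norm_prod_stftKernel_le k p i
  have hint : Integrable fun t => ‖f t‖ * Real.exp (-(1 / 2) * ‖t‖ ^ 2) :=
    hf.norm.integrable_mul (memLp_two_exp_neg_mul_sq_norm (by norm_num))
  have hbd : ∀ z t, ‖f t * ∏ j, stftKernel (k j) (Function.update (fun m => (p m : ℂ)) i z (.inl j))
        (Function.update (fun m => (p m : ℂ)) i z (.inr j)) (t j)‖ ≤
        C * Real.exp (9 / 2 * ‖z‖ ^ 2) * (‖f t‖ * Real.exp (-(1 / 2) * ‖t‖ ^ 2)) := by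
    intro z t
    rw [norm_mul]
    refine (mul_le_mul_of_nonneg_left (h z t) (norm_nonneg _)).trans_eq ?_
    ring
  constructor
  · refine differentiable_integral_of_dominated (fun t => ?_) (fun z => ?_) (fun R => ?_)
    · refine Differentiable.const_mul (Differentiable.fun_finsetProd fun j _ => ?_) _
      have h1 := Differentiable.update (fun m => (p m : ℂ)) i (.inl j)
      have h2 := Differentiable.update (fun m => (p m : ℂ)) i (.inr j)
      have h3 := differentiable_hermiteEntire (k j)
      unfold stftKernel
      fun_prop
    · refine hf.1.mul (Continuous.aestronglyMeasurable ?_)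
      refine continuous_finsetProd _ fun j _ => ?_
      have h3 := (differentiable_hermiteEntire (k j)).continuous
      unfold stftKernel
      fun_prop
    · refine ⟨_, hint.const_mul (C * Real.exp (9 / 2 * R ^ 2)), fun z hz t => (hbd z t).trans ?_⟩
      gcongr
  · refine ⟨C * ∫ t, ‖f t‖ * Real.exp (-(1 / 2) * ‖t‖ ^ 2), by positivity, fun z => ?_⟩
    refine (norm_integral_le_of_norm_le (hint.const_mul (C * Real.exp (9 / 2 * ‖z‖ ^ 2)))
      (Filter.Eventually.of_forall (hbd z))).trans_eq ?_
    rw [integral_const_mul]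
    ring

/-! ### From samples to the modulus on the whole plane. -/

theorem norm_stftEntire_eq_of_update {d : ℕ} (k : Fin d → ℕ) {f h : EuclideanSpace ℝ (Fin d) → ℂ}
    (hf : MemLp f 2) (hh : MemLp h 2) {a : ℝ} (ha : 0 < a) (ha' : a ^ 2 < 1 / 17)
    (p : Fin d ⊕ Fin d → ℝ) (i : Fin d ⊕ Fin d)
    (hp : ∀ s ∈ sqrtInt, ‖stftEntire k f (fun m => (Function.update p i (a * s) m : ℝ))‖ =
      ‖stftEntire k h (fun m => (Function.update p i (a * s) m : ℝ))‖) :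
    ‖stftEntire k f (fun m => (p m : ℝ))‖ = ‖stftEntire k h (fun m => (p m : ℝ))‖ := by
  set F : ℂ → ℂ := fun z => stftEntire k f (Function.update (fun m => (p m : ℂ)) i z) with hF
  set H : ℂ → ℂ := fun z => stftEntire k h (Function.update (fun m => (p m : ℂ)) i z) with hH
  obtain ⟨hF1, C, hC, hF2⟩ := stftEntire_update k hf p i
  obtain ⟨hH1, D, hD, hH2⟩ := stftEntire_update k hh p i
  have hupd : ∀ x : ℝ, (fun m => ((Function.update p i x m : ℝ) : ℂ)) =
      Function.update (fun m => (p m : ℂ)) i (x : ℂ) := by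
    intro x
    funext m
    by_cases hm : m = i
    · subst hm; simp
    · simp [hm]
  -- Conjugating both argument and value keeps `F` entire, so `E` is an entire extension of `‖F‖² -
  -- ‖H‖²` from the real line.
  set E : ℂ → ℂ := fun z => F z * (conj ∘ F ∘ conj) z - H z * (conj ∘ H ∘ conj) z with hE
  have hEreal : ∀ x : ℝ, E x = ((‖F x‖ ^ 2 - ‖H x‖ ^ 2 : ℝ) : ℂ) := by
    intro x
    simp only [hE, Function.comp, Complex.conj_ofReal, Complex.mul_conj']
    push_cast
    rfl
  have hEd : Differentiable ℂ E :=
    (hF1.mul fun z => differentiableAt_conj_conj_iff.mpr (hF1 _)).sub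
      (hH1.mul fun z => differentiableAt_conj_conj_iff.mpr (hH1 _))
  have hprod : ∀ (G : ℂ → ℂ) (B : ℝ), 0 ≤ B →
      (∀ z, ‖G z‖ ≤ B * Real.exp (9 / 2 * ‖z‖ ^ 2)) → ∀ z,
      ‖G z * (conj ∘ G ∘ conj) z‖ ≤ B ^ 2 * Real.exp (9 * ‖z‖ ^ 2) := by
    intro G B hB hG z
    rw [norm_mul, Function.comp, Function.comp, RCLike.norm_conj]
    have h1 := hG (conj z)
    rw [RCLike.norm_conj] at h1
    calc _ ≤ (B * Real.exp (9 / 2 * ‖z‖ ^ 2)) * (B * Real.exp (9 / 2 * ‖z‖ ^ 2)) := by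
          gcongr; exact hG z
      _ = B ^ 2 * (Real.exp (9 / 2 * ‖z‖ ^ 2) * Real.exp (9 / 2 * ‖z‖ ^ 2)) := by ring
      _ = _ := by rw [← Real.exp_add]; ring_nf
  have hE0 : E = 0 := by
    refine eq_zero_of_zeros hEd ha ha' (fun s hs => ?_) (C := C ^ 2 + D ^ 2) fun z => ?_
    · have := hp s hs
      rw [hupd] at this
      rw [hEreal, show ‖F (a * s : ℝ)‖ = ‖H (a * s : ℝ)‖ from this, sub_self, Complex.ofReal_zero]
    · rw [add_mul]
      exact (norm_sub_le _ _).trans (add_le_add (hprod F C hC hF2 z) (hprod H D hD hH2 z))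
  have h1 := hEreal (p i)
  rw [hE0, Pi.zero_apply] at h1
  have h2 : ‖F (p i)‖ ^ 2 - ‖H (p i)‖ ^ 2 = 0 := by exact_mod_cast h1.symm
  have h3 : ‖F (p i)‖ = ‖H (p i)‖ :=
    (pow_left_inj₀ (norm_nonneg _) (norm_nonneg _) two_ne_zero).mp (sub_eq_zero.mp h2)
  simpa [hF, hH, Function.update_eq_self_iff.mpr] using h3

/-- Induction on the set of coordinates allowed to lie outside `S`. -/
theorem forall_of_forall_update {ι : Type*} [Fintype ι] [DecidableEq ι] (S : Set ℝ)
    (Q : (ι → ℝ) → Prop)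
    (h1 : ∀ p i, (∀ s ∈ S, Q (Function.update p i s)) → Q p)
    (h2 : ∀ p, (∀ i, p i ∈ S) → Q p) (p : ι → ℝ) : Q p := by
  have key : ∀ A : Finset ι, ∀ p : ι → ℝ, (∀ i ∉ A, p i ∈ S) → Q p := by
    intro A
    induction A using Finset.induction_on with
    | empty => exact fun p hp => h2 p fun i => hp i (Finset.notMem_empty i)
    | insert a A _ ih =>
      refine fun p hp => h1 p a fun s hs => ih _ fun i hi => ?_
      by_cases hia : i = a
      · subst hia; simpa using hs
      · simpa [hia] using hp i (by simp [hia, hi])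
  exact key Finset.univ p (by simp)

/-- Phaseless samples on `α (√ℤ)²ᵈ` determine the modulus of the short-time Fourier transform. -/
theorem norm_stft_eq_of_samples {d : ℕ} (k : Fin d → ℕ) {f h : EuclideanSpace ℝ (Fin d) → ℂ}
    (hf : MemLp f 2) (hh : MemLp h 2) {a : ℝ} (ha : 0 < a) (ha' : a ^ 2 < 1 / 17)
    (hp : ∀ p ∈ a • sqrtIntPow d, ‖stft (hermiteTensor k) f p‖ = ‖stft (hermiteTensor k) h p‖)
    (p : EuclideanSpace ℝ (Fin d) × EuclideanSpace ℝ (Fin d)) :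
    ‖stft (hermiteTensor k) f p‖ = ‖stft (hermiteTensor k) h p‖ := by
  simp_rw [← stftEntire_ofReal]
  refine forall_of_forall_update {x | ∃ s ∈ sqrtInt, x = a * s}
    (fun q => ‖stftEntire k f fun i => (q i : ℂ)‖ = ‖stftEntire k h fun i => (q i : ℂ)‖)
    (fun q i hq => ?_) (fun q hq => ?_) _
  · exact norm_stftEntire_eq_of_update k hf hh ha ha' q i fun s hs => hq _ ⟨s, hs, rfl⟩
  · choose s hs hqs using hq
    have hmem : (WithLp.toLp 2 fun j => q (.inl j), WithLp.toLp 2 fun j => q (.inr j)) ∈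
        a • sqrtIntPow d := by
      refine ⟨(WithLp.toLp 2 fun j => s (.inl j), WithLp.toLp 2 fun j => s (.inr j)),
        ⟨fun j => hs _, fun j => hs _⟩, ?_⟩
      ext j <;> simp [hqs]
    have h1 := hp _ hmem
    simp_rw [← stftEntire_ofReal] at h1
    have h2 : (fun i => ((Sum.elim (fun j => q (.inl j)) (fun j => q (.inr j)) i : ℝ) : ℂ)) =
        fun i => (q i : ℂ) := by
      funext i
      rcases i with j | j <;> rfl
    exact h2 ▸ h1

/-! ### Fourier injectivity, deconvolution and autocorrelation. -/

section Fourier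

open FourierTransform Filter Topology
open scoped ContDiff

variable {V : Type*} [NormedAddCommGroup V] [InnerProductSpace ℝ V] [FiniteDimensional ℝ V]
  [MeasurableSpace V] [BorelSpace V]

/-- The Fourier transform is injective on integrable functions. -/
theorem ae_eq_zero_of_fourier_eq_zero {u : V → ℂ} (hu : Integrable u) (h : ∀ ξ, 𝓕 u ξ = 0) :
    ∀ᵐ t, u t = 0 := by
  refine ae_eq_zero_of_integral_contDiff_smul_eq_zero hu.locallyIntegrable fun g hg hgc => ?_
  have hg₁ : HasCompactSupport (Complex.ofRealCLM ∘ g) := hgc.comp_left rfl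
  have hg₂ : ContDiff ℝ ∞ (Complex.ofRealCLM ∘ g) := by fun_prop
  -- Each test function is the Fourier transform of a Schwartz function `ψ`, so the transform can be
  -- moved onto `u`.
  set φ : SchwartzMap V ℂ := hg₁.toSchwartzMap hg₂
  set ψ : SchwartzMap V ℂ := 𝓕⁻ φ with hψ
  have h1 : ∀ x, 𝓕 (ψ : V → ℂ) x = g x := by
    intro x
    rw [← SchwartzMap.fourier_coe, hψ, FourierTransform.fourier_fourierInv_eq]
    rfl
  have h2 : ∫ ξ, 𝓕 (ψ : V → ℂ) ξ • u ξ = ∫ x, ψ x • 𝓕 u x := by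
    simpa using! (VectorFourier.integral_fourierIntegral_smul_eq_flip (L := innerₗ V)
      Real.continuous_fourierChar continuous_inner ψ.integrable hu)
  simp only [h1, h, smul_zero, integral_zero] at h2
  simpa using h2

/-- Gaussian decay extends the Fourier transform to an entire function on every complexified line.
If it vanished near `ξ₀`, the identity theorem on lines through `ξ₀` would make it vanish
everywhere, contradicting injectivity. -/
theorem dense_fourier_ne_zero {d : ℕ} {K : EuclideanSpace ℝ (Fin d) → ℂ} (hK : Continuous K)
    {C b : ℝ} (hb : 0 < b) (hC : ∀ t, ‖K t‖ ≤ C * Real.exp (-b * ‖t‖ ^ 2)) (hK0 : ∃ t, K t ≠ 0) :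
    Dense {ξ | 𝓕 K ξ ≠ 0} := by
  have hC0 : 0 ≤ C := by simpa using (norm_nonneg _).trans (hC 0)
  by_contra hd
  obtain ⟨ξ₀, hξ₀⟩ : ∃ ξ₀, ∀ᶠ ξ in 𝓝 ξ₀, 𝓕 K ξ = 0 := by
    simp only [Dense, not_forall, mem_closure_iff_frequently, not_frequently] at hd
    obtain ⟨ξ₀, h⟩ := hd
    exact ⟨ξ₀, h.mono fun ξ hξ => not_not.mp hξ⟩
  have hzero : ∀ ξ, 𝓕 K ξ = 0 := by
    intro ξ
    set G : ℂ → ℂ := fun z => ∫ t, K t * Complex.exp (-2 * Real.pi * Complex.I *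
      ((inner ℝ t ξ₀ : ℝ) + z * (inner ℝ t (ξ - ξ₀) : ℝ))) with hG
    have hGd : Differentiable ℂ G := by
      refine differentiable_integral_of_dominated (fun t => by fun_prop)
        (fun z => Continuous.aestronglyMeasurable (by fun_prop)) fun R => ?_
      set c := 2 * Real.pi * (|R| * ‖ξ - ξ₀‖) with hc
      have hc0 : 0 ≤ c := by positivity
      refine ⟨fun t => C * Real.exp (c ^ 2 / (2 * b)) * Real.exp (-(b / 2) * ‖t‖ ^ 2),
        (integrable_exp_neg_mul_sq_norm (by positivity)).const_mul _, fun z hz t => ?_⟩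
      rw [norm_mul, Complex.norm_exp]
      have h1 : (-2 * (Real.pi : ℂ) * Complex.I *
          ((inner ℝ t ξ₀ : ℝ) + z * (inner ℝ t (ξ - ξ₀) : ℝ))).re =
          2 * Real.pi * (z.im * inner ℝ t (ξ - ξ₀)) := by
        simp
      have h2 : z.im * inner ℝ t (ξ - ξ₀) ≤ |R| * ‖ξ - ξ₀‖ * ‖t‖ := by
        refine (le_abs_self _).trans ?_
        rw [abs_mul, mul_assoc, mul_comm ‖ξ - ξ₀‖]
        exact mul_le_mul (((Complex.abs_im_le_norm z).trans hz).trans (le_abs_self R))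
          (abs_real_inner_le_norm _ _) (abs_nonneg _) (abs_nonneg _)
      have h3 : 2 * Real.pi * (z.im * inner ℝ t (ξ - ξ₀)) ≤ c * ‖t‖ := by
        rw [hc, mul_assoc (2 * Real.pi)]
        exact mul_le_mul_of_nonneg_left h2 (by positivity)
      have h4 : c * ‖t‖ ≤ c ^ 2 / (2 * b) + b / 2 * ‖t‖ ^ 2 := by
        have h5 : c ^ 2 / (2 * b) + b / 2 * ‖t‖ ^ 2 - c * ‖t‖ = (c - b * ‖t‖) ^ 2 / (2 * b) := by
          field_simp
          ring
        have : 0 ≤ (c - b * ‖t‖) ^ 2 / (2 * b) := by positivity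
        linarith
      rw [h1]
      calc _ ≤ C * Real.exp (-b * ‖t‖ ^ 2) * Real.exp (c ^ 2 / (2 * b) + b / 2 * ‖t‖ ^ 2) :=
            mul_le_mul (hC t) (Real.exp_le_exp.mpr (h3.trans h4)) (Real.exp_pos _).le
              (by positivity)
        _ = _ := by
            simp only [mul_assoc C, ← Real.exp_add]
            ring_nf
    have hGreal : ∀ x : ℝ, G x = 𝓕 K (ξ₀ + x • (ξ - ξ₀)) := by
      intro x
      rw [hG, Real.fourier_eq']
      refine integral_congr_ae (Eventually.of_forall fun t => ?_)
      simp only [inner_add_right, inner_smul_right, smul_eq_mul]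
      rw [mul_comm]
      congr 2
      push_cast
      ring
    have hu : Tendsto (fun n : ℕ => ((1 / ((n : ℝ) + 1) : ℝ) : ℂ)) atTop (𝓝[≠] 0) := by
      refine tendsto_nhdsWithin_iff.mpr ⟨?_, Eventually.of_forall fun n => ?_⟩
      · exact_mod_cast (Complex.continuous_ofReal.tendsto 0).comp
          (tendsto_one_div_add_atTop_nhds_zero_nat (𝕜 := ℝ))
      · have : (1 / ((n : ℝ) + 1) : ℝ) ≠ 0 := by positivity
        simpa only [Set.mem_compl_iff, Set.mem_singleton_iff, Complex.ofReal_eq_zero] using this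
    have hl : Tendsto (fun n : ℕ => ξ₀ + (1 / ((n : ℝ) + 1) : ℝ) • (ξ - ξ₀)) atTop (𝓝 ξ₀) := by
      simpa using tendsto_const_nhds.add
        ((tendsto_one_div_add_atTop_nhds_zero_nat (𝕜 := ℝ)).smul_const (ξ - ξ₀))
    have hfreq : ∃ᶠ z in 𝓝[≠] (0 : ℂ), G z = (0 : ℂ → ℂ) z := by
      refine hu.frequently (Eventually.frequently ?_)
      filter_upwards [hl.eventually hξ₀] with n hn
      rw [hGreal, hn, Pi.zero_apply]
    have hG0 : G = 0 := AnalyticOnNhd.eq_of_frequently_eq (fun z _ => hGd.analyticAt z)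
      (fun z _ => analyticAt_const) hfreq
    have h1 := hGreal 1
    rw [hG0] at h1
    simpa using h1.symm
  have hKi : Integrable K :=
    ((integrable_exp_neg_mul_sq_norm hb).const_mul C).mono' hK.aestronglyMeasurable
      (Eventually.of_forall hC)
  obtain ⟨t, ht⟩ := hK0
  have h1 : K =ᵐ[volume] fun _ => 0 := ae_eq_zero_of_fourier_eq_zero hKi hzero
  exact ht (congrFun ((Continuous.ae_eq_iff_eq volume hK continuous_const).mp h1) t)

-- The integrals are a convolution with the reflected kernel, so the product of Fourier transforms
-- vanishes. One factor is nonzero on a dense set and the other is continuous, hence zero.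
open Convolution in
theorem ae_eq_zero_of_forall_integral_mul_translate_eq_zero {d : ℕ}
    {φ K : EuclideanSpace ℝ (Fin d) → ℂ} (hφ : Integrable φ) (hK : Continuous K)
    {C b : ℝ} (hb : 0 < b) (hC : ∀ t, ‖K t‖ ≤ C * Real.exp (-b * ‖t‖ ^ 2)) (hK0 : ∃ t, K t ≠ 0)
    (h : ∀ x, ∫ r, φ r * K (r - x) = 0) : ∀ᵐ r, φ r = 0 := by
  set L : EuclideanSpace ℝ (Fin d) → ℂ := fun y => K (-y) with hL
  have hLc : Continuous L := by fun_prop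
  have hLC : ∀ t, ‖L t‖ ≤ C * Real.exp (-b * ‖t‖ ^ 2) := fun t => by simpa using hC (-t)
  have hL0 : ∃ t, L t ≠ 0 := by
    obtain ⟨t, ht⟩ := hK0
    exact ⟨-t, by simpa [hL] using ht⟩
  have hLi : Integrable L :=
    ((integrable_exp_neg_mul_sq_norm hb).const_mul C).mono' hLc.aestronglyMeasurable
      (Eventually.of_forall hLC)
  have hconv : φ ⋆[ContinuousLinearMap.mul ℂ ℂ] L = 0 := by
    funext x
    rw [convolution_def, Pi.zero_apply, ← h x]
    refine integral_congr_ae (Eventually.of_forall fun r => ?_)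
    simp [hL]
  have hprod : ∀ ξ, 𝓕 φ ξ * 𝓕 L ξ = 0 := by
    intro ξ
    rw [← Real.fourier_mul_convolution_eq hφ hLi, hconv, Real.fourier_eq']
    simp
  have hcont : Continuous (𝓕 φ) :=
    VectorFourier.fourierIntegral_continuous Real.continuous_fourierChar
      (by exact continuous_inner) hφ
  have hF : 𝓕 φ = fun _ => 0 := by
    refine Continuous.ext_on (dense_fourier_ne_zero hLc hb hLC hL0) hcont continuous_const ?_
    intro ξ hξ
    exact (mul_eq_zero.mp (hprod ξ)).resolve_right hξ
  exact ae_eq_zero_of_fourier_eq_zero hφ (congrFun hF)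

-- The autocorrelation of `w` is integrable with Fourier transform `‖𝓕 w‖²`, so injectivity applies
-- to the difference.
open Convolution in
theorem ae_autocorrelation_eq_of_norm_fourier_eq {u v : V → ℂ} (hu : Integrable u)
    (hv : Integrable v) (h : ∀ ξ, ‖𝓕 u ξ‖ = ‖𝓕 v ξ‖) :
    ∀ᵐ s, ∫ r, conj (u r) * u (s + r) = ∫ r, conj (v r) * v (s + r) := by
  have key : ∀ w : V → ℂ, Integrable w →
      Integrable (fun s => ∫ r, conj (w r) * w (s + r)) ∧
      ∀ ξ, 𝓕 (fun s => ∫ r, conj (w r) * w (s + r)) ξ = (‖𝓕 w ξ‖ : ℂ) ^ 2 := by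
    intro w hw
    set w' : V → ℂ := fun t => conj (w (-t)) with hw'
    have hwi : Integrable w' := (Complex.conjCLE.integrable_comp_iff.mpr hw).comp_neg
    have h1 : (fun s => ∫ r, conj (w r) * w (s + r)) = w' ⋆[ContinuousLinearMap.mul ℂ ℂ] w := by
      funext s
      rw [convolution_def, ← integral_neg_eq_self]
      refine integral_congr_ae (Eventually.of_forall fun r => ?_)
      simp [hw', sub_eq_add_neg]
    have h2 : ∀ ξ, 𝓕 w' ξ = conj (𝓕 w ξ) := by
      intro ξ
      rw [Real.fourier_eq', Real.fourier_eq', ← integral_conj, ← integral_neg_eq_self]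
      refine integral_congr_ae (Eventually.of_forall fun r => ?_)
      simp [hw', ← Complex.exp_conj, map_ofNat (starRingEnd ℂ) 2]
    rw [h1]
    refine ⟨hwi.integrable_convolution _ hw, fun ξ => ?_⟩
    rw [Real.fourier_mul_convolution_eq hwi hw, h2, Complex.conj_mul']
  obtain ⟨hu1, hu2⟩ := key u hu
  obtain ⟨hv1, hv2⟩ := key v hv
  have h0 := ae_eq_zero_of_fourier_eq_zero (hu1.sub hv1) fun ξ => by
    rw [show 𝓕 ((fun s => ∫ r, conj (u r) * u (s + r)) - fun s => ∫ r, conj (v r) * v (s + r)) ξ =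
      𝓕 (fun s => ∫ r, conj (u r) * u (s + r)) ξ - 𝓕 (fun s => ∫ r, conj (v r) * v (s + r)) ξ from
      ?_, hu2, hv2, h, sub_self]
    simp only [Real.fourier_eq, Pi.sub_apply, smul_sub]
    exact integral_sub ((Real.fourierIntegral_convergent_iff ξ).mpr hu1)
      ((Real.fourierIntegral_convergent_iff ξ).mpr hv1)
  filter_upwards [h0] with s hs
  exact sub_eq_zero.mp hs

end Fourier

/-! ### Recovering the rank-one kernel from the modulus. -/

theorem continuous_hermiteTensor {d : ℕ} (k : Fin d → ℕ) : Continuous (hermiteTensor k) := by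
  have := fun n => continuous_hermiteFun n
  unfold hermiteTensor
  fun_prop

theorem exists_norm_hermiteTensor_le {d : ℕ} (k : Fin d → ℕ) :
    ∃ C : ℝ, 0 ≤ C ∧ ∀ t, ‖hermiteTensor k t‖ ≤ C * Real.exp (-3 * ‖t‖ ^ 2) := by
  choose C hC h using exists_norm_hermiteEntire_le
  refine ⟨∏ j, C (k j), Finset.prod_nonneg fun j _ => hC _, fun t => ?_⟩
  rw [hermiteTensor, Complex.ofReal_prod, norm_prod, EuclideanSpace.real_norm_sq_eq,
    Finset.mul_sum, Real.exp_sum, ← Finset.prod_mul_distrib]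
  refine Finset.prod_le_prod (fun j _ => norm_nonneg _) fun j _ => ?_
  rw [← hermiteEntire_ofReal]
  simpa using h (k j) (t j)

theorem exists_hermiteTensor_mul_translate_ne_zero {d : ℕ} (k : Fin d → ℕ)
    (s : EuclideanSpace ℝ (Fin d)) : ∃ y, hermiteTensor k y * hermiteTensor k (s + y) ≠ 0 := by
  have h : ∀ j, ∃ y : ℝ, hermiteFun (k j) y ≠ 0 ∧ hermiteFun (k j) (s j + y) ≠ 0 := by
    intro j
    have h1 := finite_hermiteFun_eq_zero (k j)
    have h2 := h1.preimage (add_right_injective (s j)).injOn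
    obtain ⟨y, hy⟩ := (h1.union h2).exists_notMem
    rw [Set.mem_union, not_or] at hy
    exact ⟨y, hy.1, hy.2⟩
  choose y hy1 hy2 using h
  refine ⟨WithLp.toLp 2 y, mul_ne_zero ?_ ?_⟩ <;>
    rw [hermiteTensor, Complex.ofReal_ne_zero, Finset.prod_ne_zero_iff] <;> intro j _
  · exact hy1 j
  · exact hy2 j

theorem memLp_hermiteTensor_translate {d : ℕ} (k : Fin d → ℕ) (x : EuclideanSpace ℝ (Fin d)) :
    MemLp (fun t => hermiteTensor k (t - x)) 2 := by
  obtain ⟨C, hC, h⟩ := exists_norm_hermiteTensor_le k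
  have h1 : MemLp (hermiteTensor k) 2 :=
    ((memLp_two_exp_neg_mul_sq_norm (d := d) (b := 3) (by norm_num)).const_mul C).mono'
      (continuous_hermiteTensor k).aestronglyMeasurable (Filter.Eventually.of_forall h)
  exact h1.comp_measurePreserving (measurePreserving_sub_right volume x)

open FourierTransform in
theorem stft_eq_fourier {d : ℕ} (g f : EuclideanSpace ℝ (Fin d) → ℂ)
    (x ω : EuclideanSpace ℝ (Fin d)) :
    stft g f (x, ω) = 𝓕 (fun t => f t * conj (g (t - x))) ω := by
  rw [stft, Real.fourier_eq']
  refine integral_congr_ae (Filter.Eventually.of_forall fun t => ?_)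
  simp only [smul_eq_mul]
  rw [mul_comm]
  congr 2
  rw [PiLp.inner_apply]
  simp only [RCLike.inner_apply, conj_trivial]
  push_cast
  ring

theorem integrable_conj_mul_translate {d : ℕ} {f : EuclideanSpace ℝ (Fin d) → ℂ} (hf : MemLp f 2)
    (s : EuclideanSpace ℝ (Fin d)) : Integrable fun r => conj (f r) * f (s + r) :=
  hf.star.integrable_mul (hf.comp_measurePreserving (measurePreserving_add_left volume s))

/-- The modulus of the short-time Fourier transform with a Hermite window determines the
rank-one kernel `conj (f r) * f t`. -/
theorem ae_conj_mul_translate_eq {d : ℕ} (k : Fin d → ℕ) {f h : EuclideanSpace ℝ (Fin d) → ℂ}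
    (hf : MemLp f 2) (hh : MemLp h 2)
    (hfh : ∀ p, ‖stft (hermiteTensor k) f p‖ = ‖stft (hermiteTensor k) h p‖) :
    ∀ᵐ s, ∀ᵐ r, conj (f r) * f (s + r) = conj (h r) * h (s + r) := by
  obtain ⟨C, hC, hg⟩ := exists_norm_hermiteTensor_le k
  have hgc := continuous_hermiteTensor k
  have hconj : ∀ t, conj (hermiteTensor k t) = hermiteTensor k t := fun t => Complex.conj_ofReal _
  have hKc : ∀ s, Continuous fun y => hermiteTensor k y * hermiteTensor k (s + y) :=
    fun s => by fun_prop
  have hK : ∀ s y, ‖hermiteTensor k y * hermiteTensor k (s + y)‖ ≤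
      C * C * Real.exp (-3 * ‖y‖ ^ 2) := by
    intro s y
    have h1 : ‖hermiteTensor k (s + y)‖ ≤ C := (hg _).trans
      (mul_le_of_le_one_right hC (Real.exp_le_one_iff.mpr (by nlinarith [sq_nonneg ‖s + y‖])))
    rw [norm_mul]
    calc _ ≤ (C * Real.exp (-3 * ‖y‖ ^ 2)) * C := by gcongr; exact hg y
      _ = _ := by ring
  have hKb : ∀ s y, ‖hermiteTensor k y * hermiteTensor k (s + y)‖ ≤ C * C := fun s y =>
    (hK s y).trans (mul_le_of_le_one_right (by positivity)
      (Real.exp_le_one_iff.mpr (by nlinarith [sq_nonneg ‖y‖])))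
  set φ : EuclideanSpace ℝ (Fin d) → EuclideanSpace ℝ (Fin d) → ℂ :=
    fun s r => conj (f r) * f (s + r) - conj (h r) * h (s + r) with hφ
  have hφi : ∀ s, Integrable (φ s) := fun s =>
    (integrable_conj_mul_translate hf s).sub (integrable_conj_mul_translate hh s)
  -- For fixed `x`, compare the autocorrelations of `f` and `h` multiplied by the window translated
  -- to `x`.
  have hx : ∀ x, ∀ᵐ s,
      ∫ r, φ s r * (hermiteTensor k (r - x) * hermiteTensor k (s + (r - x))) = 0 := by
    intro x
    have hi : ∀ u : EuclideanSpace ℝ (Fin d) → ℂ, MemLp u 2 →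
        Integrable fun t => u t * conj (hermiteTensor k (t - x)) := by
      intro u hu
      simp_rw [hconj]
      exact hu.integrable_mul (memLp_hermiteTensor_translate k x)
    filter_upwards [ae_autocorrelation_eq_of_norm_fourier_eq (hi f hf) (hi h hh) fun ξ => by
      rw [← stft_eq_fourier, ← stft_eq_fourier, hfh]] with s hs
    have hb : ∀ u : EuclideanSpace ℝ (Fin d) → ℂ, MemLp u 2 → Integrable fun r =>
        conj (u r) * u (s + r) * (hermiteTensor k (r - x) * hermiteTensor k (s + (r - x))) := by
      intro u hu
      refine (integrable_conj_mul_translate hu s).mul_bdd (c := C * C)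
        (Continuous.aestronglyMeasurable ?_) (Filter.Eventually.of_forall fun r => hKb s (r - x))
      exact (hKc s).comp (continuous_id.sub continuous_const)
    simp only [hφ, sub_mul]
    rw [integral_sub (hb f hf) (hb h hh), sub_eq_zero]
    convert hs using 1 <;>
    · refine integral_congr_ae (Filter.Eventually.of_forall fun r => ?_)
      simp only [map_mul, hconj, add_sub_assoc]
      ring
  -- The exceptional null set of `s` depends on `x`. A countable dense set of `x` gives a common
  -- one, and continuity in `x` then covers all `x`.
  obtain ⟨D, hDc, hDd⟩ := TopologicalSpace.exists_countable_dense (EuclideanSpace ℝ (Fin d))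
  have hD := (ae_ball_iff hDc).mpr fun x (_ : x ∈ D) => hx x
  filter_upwards [hD] with s hs
  have hcont : Continuous fun x =>
      ∫ r, φ s r * (hermiteTensor k (r - x) * hermiteTensor k (s + (r - x))) := by
    refine continuous_of_dominated (bound := fun r => ‖φ s r‖ * (C * C)) (fun x => ?_)
      (fun x => Filter.Eventually.of_forall fun r => ?_) ((hφi s).norm.mul_const _)
      (Filter.Eventually.of_forall fun r => ?_)
    · exact (hφi s).1.mul (Continuous.aestronglyMeasurable
        ((hKc s).comp (continuous_id.sub continuous_const)))
    · rw [norm_mul]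
      exact mul_le_mul_of_nonneg_left (hKb s _) (norm_nonneg _)
    · exact continuous_const.mul ((hKc s).comp (continuous_const.sub continuous_id))
  have hzero := Continuous.ext_on hDd hcont continuous_const hs
  filter_upwards [ae_eq_zero_of_forall_integral_mul_translate_eq_zero (hφi s) (hKc s)
    (by norm_num : (0 : ℝ) < 3) (hK s) (exists_hermiteTensor_mul_translate_ne_zero k s)
    (congrFun hzero)] with r hr
  exact sub_eq_zero.mp hr

/-! ### From the kernel to a global phase. -/

theorem ae_eq_zero_of_ae_conj_mul_eq_zero {T : Type*} [MeasurableSpace T] {μ : Measure T}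
    {h : T → ℂ} (hh : ∀ᵐ r ∂μ, ∀ᵐ t ∂μ, conj (h r) * h t = 0) : ∀ᵐ t ∂μ, h t = 0 := by
  by_contra hne
  obtain ⟨r, hr0, hr⟩ := (Filter.not_eventually.mp hne).and_eventually hh |>.exists
  refine hne (hr.mono fun t ht => ?_)
  simpa [hr0] using ht

/-- Freezing a generic `r` with `f r ≠ 0` gives `f = c h`. Substituting back yields `(‖c‖² - 1) conj
(h r') h t = 0`, so `‖c‖ = 1` unless `h`, and with it `f`, vanishes almost everywhere. -/
theorem exists_norm_eq_one_and_ae_eq_mul {T : Type*} [MeasurableSpace T] {μ : Measure T}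
    {f h : T → ℂ} (hfh : ∀ᵐ r ∂μ, ∀ᵐ t ∂μ, conj (f r) * f t = conj (h r) * h t) :
    ∃ τ : ℂ, ‖τ‖ = 1 ∧ ∀ᵐ t ∂μ, f t = τ * h t := by
  by_cases hf : ∀ᵐ t ∂μ, f t = 0
  · have h0 : ∀ᵐ t ∂μ, h t = 0 := by
      refine ae_eq_zero_of_ae_conj_mul_eq_zero ?_
      filter_upwards [hfh, hf] with r hr hfr
      filter_upwards [hr] with t ht
      rw [← ht, hfr, map_zero, zero_mul]
    refine ⟨1, norm_one, ?_⟩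
    filter_upwards [hf, h0] with t h1 h2
    rw [h1, h2, mul_zero]
  · obtain ⟨r, hr0, hr⟩ := (Filter.not_eventually.mp hf).and_eventually hfh |>.exists
    set c := conj (h r) / conj (f r) with hc
    have hfc : ∀ᵐ t ∂μ, f t = c * h t := by
      filter_upwards [hr] with t ht
      have : conj (f r) ≠ 0 := by simpa using hr0
      rw [hc, div_mul_eq_mul_div, ← ht, mul_div_cancel_left₀ _ this]
    refine ⟨c, ?_, hfc⟩
    by_contra hne
    have hsq : (‖c‖ : ℂ) ^ 2 - 1 ≠ 0 := by
      rw [sub_ne_zero]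
      intro h1
      have h2 : ‖c‖ ^ 2 = 1 := by exact_mod_cast h1
      exact hne ((pow_eq_one_iff_of_nonneg (norm_nonneg c) two_ne_zero).mp h2)
    have h0 : ∀ᵐ t ∂μ, h t = 0 := by
      refine ae_eq_zero_of_ae_conj_mul_eq_zero ?_
      filter_upwards [hfh, hfc] with r' hr' hcr
      filter_upwards [hr', hfc] with t ht hct
      rw [hcr, hct, map_mul] at ht
      have h1 : ((‖c‖ : ℂ) ^ 2 - 1) * (conj (h r') * h t) = 0 := by
        rw [← Complex.conj_mul']
        linear_combination ht
      exact (mul_eq_zero.mp h1).resolve_left hsq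
    refine hf ?_
    filter_upwards [hfc, h0] with t h1 h2
    rw [h1, h2, mul_zero]

/-- Phase retrieval: the modulus of the short-time Fourier transform with a Hermite window
determines a square-integrable function up to a global phase. -/
theorem phaseEquiv_of_norm_stft_eq {d : ℕ} (k : Fin d → ℕ) {f h : L2 d}
    (hfh : ∀ p, ‖stft (hermiteTensor k) f p‖ = ‖stft (hermiteTensor k) h p‖) : PhaseEquiv f h := by
  have hfm : Measurable f := (Lp.stronglyMeasurable f).measurable
  have hhm : Measurable h := (Lp.stronglyMeasurable h).measurable
  have h1 := ae_conj_mul_translate_eq k (Lp.memLp f) (Lp.memLp h) hfh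
  -- Fubini swaps the quantifiers, so that for fixed `r` the translation `t = s + r` preserves null
  -- sets.
  have h1' := (Measure.ae_ae_comm
    (p := fun s r => conj (f r) * f (s + r) = conj (h r) * h (s + r)) (measurableSet_eq_fun
    ((Complex.continuous_conj.measurable.comp (hfm.comp measurable_snd)).mul
      (hfm.comp (measurable_fst.add measurable_snd)))
    ((Complex.continuous_conj.measurable.comp (hhm.comp measurable_snd)).mul
      (hhm.comp (measurable_fst.add measurable_snd))))).mp h1
  obtain ⟨τ, hτ, hfτ⟩ := exists_norm_eq_one_and_ae_eq_mul (μ := volume) (f := f) (h := h) (by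
    filter_upwards [h1'] with r hr
    have h2 := (measurePreserving_sub_right volume r).quasiMeasurePreserving.ae hr
    filter_upwards [h2] with t ht
    simpa using ht)
  refine ⟨τ, hτ, Lp.ext ?_⟩
  filter_upwards [hfτ, Lp.coeFn_smul τ h] with t h2 h3
  rw [h2, h3]
  rfl

theorem norm_stft_eq_of_phaseEquiv {d : ℕ} (g : EuclideanSpace ℝ (Fin d) → ℂ) {f h : L2 d}
    (hfh : PhaseEquiv f h) (p : EuclideanSpace ℝ (Fin d) × EuclideanSpace ℝ (Fin d)) :
    ‖stft g f p‖ = ‖stft g h p‖ := by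
  obtain ⟨τ, hτ, rfl⟩ := hfh
  have h1 : stft g (τ • h : L2 d) p = τ * stft g h p := by
    rw [stft, stft, ← integral_const_mul]
    refine integral_congr_ae ?_
    filter_upwards [Lp.coeFn_smul τ h] with t ht
    rw [ht, Pi.smul_apply, smul_eq_mul]
    ring
  rw [h1, norm_mul, hτ, one_mul]

theorem corollary3 (d : ℕ) (k : Fin d → ℕ) (α : ℝ) (hα₀ : 0 < α)
    (hα : α < √(1 / (2 * Real.pi * Real.exp 1))) (f h : L2 d) :
    (∀ p ∈ α • sqrtIntPow d, ‖stft (hermiteTensor k) f p‖ = ‖stft (hermiteTensor k) h p‖) ↔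
      PhaseEquiv f h := by
  refine ⟨fun hp => phaseEquiv_of_norm_stft_eq k
    (norm_stft_eq_of_samples k (Lp.memLp f) (Lp.memLp h) hα₀ ?_ hp),
    fun hfh p _ => norm_stft_eq_of_phaseEquiv _ hfh p⟩
  -- The hypothesis on `α` enters only through `2πe ≥ 17`.
  refine ((Real.lt_sqrt hα₀.le).mp hα).trans_le (one_div_le_one_div_of_le (by norm_num) ?_)
  nlinarith [Real.pi_gt_d4, Real.exp_one_gt_d9]
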